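/- Let $R$ and $S$ be associative rings with unit and let ${}_R\omega_S$ be a semidualizing $(R,S)$-bimodule, that is: ${}_R\omega$ and $\omega_S$ have projective resolutions (over $R$ and over $S^{op}$, respectively) all of whose terms are finitely generated; the homothety maps $R\to\mathrm{Hom}_{S^{op}}(\omega,\omega)$ and $S\to\mathrm{Hom}_R(\omega,\omega)$ are isomorphisms; and $\mathrm{Ext}_R^i(\omega,\omega)=0=\mathrm{Ext}_{S^{op}}^i(\omega,\omega)$ for all $i\ge1$. For a left $S$-module $N$, the Tor-cograde of $N$ with respect to $\omega$ is $\inf\{i\ge0\mid\mathrm{Tor}_i^S(\omega,N)\ne0\}$ (with $\inf\emptyset=\infty$). Let $\mathcal P_\omega(R)$ be the class of left $R$-modules isomorphic to $\omega\otimes_SP$ for some projective left $S$-module $P$. For a left $R$-module $U$, let $\mathcal P_\omega(R)\text{-}\mathrm{id}_R\,U$ be the infimum of the integers $m\ge0$ for which there is an exact sequence $0\to U\to X^0\to\cdots\to X^m\to0$ of left $R$-modules with every $X^j$ in $\mathcal P_\omega(R)$. For a left $R$-module $M$, $\mathrm{Ext}_R^i(\omega,M)$ is a left $S$-module through the right $S$-action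 on $\omega$. **Theorem.** Let $M$ be a left $R$-module and let $n\ge1$. Suppose that for every $1\le i\le n$ the Tor-cograde of $\mathrm{Ext}_R^i(\omega,M)$ with respect to $\omega$ is at least $i$. Then there exist a left $R$-module $U$ and a homomorphism of left $R$-modules $f:U\to M$ such that 1. $\mathcal P_\omega(R)\text{-}\mathrm{id}_R\,U\le n$, and 2. $\mathrm{Ext}_R^i(\omega,f):\mathrm{Ext}_R^i(\omega,U)\to\mathrm{Ext}_R^i(\omega,M)$ is bijective for every $1\le i\le n$. -/

import Mathlib

open CategoryTheory CategoryTheory.Abelian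

universe u

noncomputable section

namespace OmegaApprox

open scoped TensorProduct

/-! An `(R, S)`-bimodule `ω` is given by commuting module structures over `R` and `Sᵐᵒᵖ`;
the right action `x s` is `MulOpposite.op s • x`. -/

section Semidualizing

/-- A left `A`-module has a degreewise finite projective resolution: a projective resolution
all of whose terms are finitely generated. -/
def HasDegreewiseFiniteResolution (A : Type u) [Ring A] (X : ModuleCat.{u} A) : Prop :=
  ∃ P : ProjectiveResolution X, ∀ i : ℕ, Module.Finite A (P.complex.X i)

/-- Semidualizing `(R, S)`-bimodules. -/
structure IsSemidualizing (R S : Type u) [Ring R] [Ring S] (ω : Type u) [AddCommGroup ω]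
    [Module R ω] [Module Sᵐᵒᵖ ω] [SMulCommClass R Sᵐᵒᵖ ω] [SMulCommClass Sᵐᵒᵖ R ω] : Prop where
  finite_left : HasDegreewiseFiniteResolution R (ModuleCat.of R ω)
  finite_right : HasDegreewiseFiniteResolution Sᵐᵒᵖ (ModuleCat.of Sᵐᵒᵖ ω)
  /-- The homothety `r ↦ (x ↦ r x)`, from `R` to the endomorphisms of `ω` over `Sᵐᵒᵖ`. -/
  homothety_left : Function.Bijective (Module.toModuleEnd (S := R) Sᵐᵒᵖ ω)
  /-- The homothety `s ↦ (x ↦ x s)`, from `S` to the endomorphisms of `ω` over `R`. -/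
  homothety_right :
    Function.Bijective (fun s : S => Module.toModuleEnd (S := Sᵐᵒᵖ) R ω (MulOpposite.op s))
  ext_left : ∀ i : ℕ, 1 ≤ i → Subsingleton (Ext (ModuleCat.of R ω) (ModuleCat.of R ω) i)
  ext_right : ∀ i : ℕ, 1 ≤ i →
    Subsingleton (Ext (ModuleCat.of Sᵐᵒᵖ ω) (ModuleCat.of Sᵐᵒᵖ ω) i)

end Semidualizing

section Tensor

variable (R S : Type u) [Ring R] [Ring S] (ω : Type u) [AddCommGroup ω]
  [Module R ω] [Module Sᵐᵒᵖ ω]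

/-- The relations `(x s) ⊗ y - x ⊗ (s y)`. For a bimodule `ω` this set is stable under the action
of `R`, so that its `R`-span is also the additive subgroup which it generates. -/
def balancedRelations (N : Type u) [AddCommGroup N] [Module S N] : Submodule R (ω ⊗[ℤ] N) :=
  Submodule.span R
    {t | ∃ (x : ω) (s : S) (y : N),
      t = (MulOpposite.op s • x) ⊗ₜ[ℤ] y - x ⊗ₜ[ℤ] (s • y)}

/-- The left `R`-module `ω ⊗_S N`. -/
abbrev BalancedTensor (N : Type u) [AddCommGroup N] [Module S N] : Type u :=
  (ω ⊗[ℤ] N) ⧸ balancedRelations R S ω N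

/-- The map `x ⊗ y ↦ x ⊗ g y` on tensor products over `ℤ`. -/
def intTensorMap {N N' : Type u} [AddCommGroup N] [AddCommGroup N'] (g : N →+ N') :
    ω ⊗[ℤ] N →ₗ[R] ω ⊗[ℤ] N' where
  toFun := TensorProduct.map (LinearMap.id : ω →ₗ[ℤ] ω) g.toIntLinearMap
  map_add' := map_add _
  map_smul' r t := by
    induction t with
    | zero => simp
    | tmul x y => simp [TensorProduct.smul_tmul']
    | add a b ha hb => simp only [smul_add, map_add, ha, hb]

@[simp]
theorem intTensorMap_tmul {N N' : Type u} [AddCommGroup N] [AddCommGroup N'] (g : N →+ N')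
    (x : ω) (y : N) : intTensorMap R ω g (x ⊗ₜ[ℤ] y) = x ⊗ₜ[ℤ] g y := rfl

/-- The `R`-linear map `ω ⊗_S g`. -/
def balancedTensorMap {N N' : Type u} [AddCommGroup N] [Module S N] [AddCommGroup N']
    [Module S N'] (g : N →ₗ[S] N') : BalancedTensor R S ω N →ₗ[R] BalancedTensor R S ω N' :=
  Submodule.mapQ _ _ (intTensorMap R ω g.toAddMonoidHom) (by
    refine Submodule.span_le.2 ?_
    rintro _ ⟨x, s, y, rfl⟩
    refine Submodule.subset_span ⟨x, s, g y, ?_⟩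
    simp)

theorem balancedTensor_hom_ext {N : Type u} [AddCommGroup N] [Module S N] {P : Type u}
    [AddCommGroup P] [Module R P] {f g : BalancedTensor R S ω N →ₗ[R] P}
    (h : ∀ (x : ω) (y : N), f (Submodule.Quotient.mk (x ⊗ₜ[ℤ] y)) =
      g (Submodule.Quotient.mk (x ⊗ₜ[ℤ] y))) : f = g := by
  refine LinearMap.ext fun t => ?_
  obtain ⟨t, rfl⟩ := Submodule.Quotient.mk_surjective _ t
  induction t with
  | zero => simp
  | tmul x y => exact h x y
  | add a b ha hb => simp only [Submodule.Quotient.mk_add, map_add, ha, hb]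

@[simp]
theorem balancedTensorMap_tmul {N N' : Type u} [AddCommGroup N] [Module S N] [AddCommGroup N']
    [Module S N'] (g : N →ₗ[S] N') (x : ω) (y : N) :
    balancedTensorMap R S ω g (Submodule.Quotient.mk (x ⊗ₜ[ℤ] y)) =
      Submodule.Quotient.mk (x ⊗ₜ[ℤ] g y) := rfl

/-- The functor `ω ⊗_S -` from left `S`-modules to left `R`-modules. -/
def tensorFunctor : ModuleCat.{u} S ⥤ ModuleCat.{u} R where
  obj N := ModuleCat.of R (BalancedTensor R S ω N)
  map g := ModuleCat.ofHom (balancedTensorMap R S ω g.hom)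
  map_id N := by
    ext1
    exact balancedTensor_hom_ext R S ω fun _ _ => rfl
  map_comp f g := by
    ext1
    exact balancedTensor_hom_ext R S ω fun _ _ => rfl

instance : (tensorFunctor R S ω).Additive where
  map_add {X Y f g} := by
    ext1
    refine balancedTensor_hom_ext R S ω fun x y => ?_
    exact congrArg (balancedRelations R S ω Y).mkQ (TensorProduct.tmul_add x (f.hom y) (g.hom y))

/-- `Tor_i^S(ω, N)`: the `i`-th left derived functor of `ω ⊗_S -`, at `N`. -/
def torModule (i : ℕ) (N : ModuleCat.{u} S) : ModuleCat.{u} R :=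
  ((tensorFunctor R S ω).leftDerived i).obj N

/-- The Tor-cograde `inf {i ≥ 0 | Tor_i^S(ω, N) ≠ 0}`, with value `⊤` if there is no such `i`. -/
def torCograde (N : ModuleCat.{u} S) : ℕ∞ :=
  ⨅ (i : ℕ) (_ : ¬ Subsingleton (torModule R S ω i N)), (i : ℕ∞)

/-- The class `𝒫_ω(R)` of the left `R`-modules (isomorphic to) `ω ⊗_S P` with `P` a projective
left `S`-module. -/
def omegaProjective : ObjectProperty (ModuleCat.{u} R) := fun X =>
  ∃ P : ModuleCat.{u} S, Module.Projective S P ∧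
    Nonempty (X ≅ (tensorFunctor R S ω).obj P)

end Tensor

section RelativeInjectiveDimension

variable {R : Type u} [Ring R]

/-- There is an exact sequence `0 → M → X⁰ → ⋯ → Xⁿ → 0` with all `Xⁱ` in the class `𝒳`
(continued by zero modules in the degrees above `n`). -/
def HasCoresolutionOfLength (𝒳 : ObjectProperty (ModuleCat.{u} R)) (M : ModuleCat.{u} R)
    (n : ℕ) : Prop :=
  ∃ (X : ℕ → ModuleCat.{u} R) (ε : M ⟶ X 0) (d : ∀ i : ℕ, X i ⟶ X (i + 1)),
    (∀ i ≤ n, 𝒳 (X i)) ∧ (∀ i, n < i → Subsingleton (X i)) ∧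
    Function.Injective ε.hom ∧ Function.Exact ε.hom (d 0).hom ∧
    ∀ i : ℕ, Function.Exact (d i).hom (d (i + 1)).hom

/-- The `𝒳`-injective dimension of `M`, with value `⊤` if there is no finite coresolution. -/
def relInjectiveDimension (𝒳 : ObjectProperty (ModuleCat.{u} R)) (M : ModuleCat.{u} R) : ℕ∞ :=
  ⨅ (n : ℕ) (_ : HasCoresolutionOfLength 𝒳 M n), (n : ℕ∞)

end RelativeInjectiveDimension

section ExtModule

variable (R S : Type u) [Ring R] [Ring S] (ω : Type u) [AddCommGroup ω]
  [Module R ω] [Module Sᵐᵒᵖ ω] [SMulCommClass Sᵐᵒᵖ R ω]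

/-- The `R`-linear endomorphism `x ↦ x s` of `ω`. -/
def rightMul (s : S) : ModuleCat.of R ω ⟶ ModuleCat.of R ω :=
  ModuleCat.ofHom (Module.toModuleEnd (S := Sᵐᵒᵖ) R ω (MulOpposite.op s))

theorem rightMul_one : rightMul R S ω 1 = 𝟙 _ := by
  ext x
  simp [rightMul]

theorem rightMul_zero : rightMul R S ω 0 = 0 := by
  ext x
  simp [rightMul]

theorem rightMul_add (s t : S) : rightMul R S ω (s + t) = rightMul R S ω s + rightMul R S ω t := by
  ext x
  simp [rightMul, add_smul]

theorem rightMul_mul (s t : S) : rightMul R S ω (s * t) = rightMul R S ω s ≫ rightMul R S ω t := by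
  ext x
  simp [rightMul, mul_smul]

/-- The left `S`-module structure on `Ext^i_R(ω, M)` induced by the right `S`-module structure of
`ω`; for `i = 0` it is `(s f)(x) = f(x s)`. -/
@[reducible]
def extModuleStructure (i : ℕ) (M : ModuleCat.{u} R) : Module S (Ext (ModuleCat.of R ω) M i) where
  smul s e := (Ext.mk₀ (rightMul R S ω s)).comp e (zero_add i)
  one_smul e := by
    change (Ext.mk₀ (rightMul R S ω 1)).comp e (zero_add i) = e
    rw [rightMul_one, Ext.mk₀_id_comp]
  mul_smul s t e := by
    change (Ext.mk₀ (rightMul R S ω (s * t))).comp e (zero_add i) =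
      (Ext.mk₀ (rightMul R S ω s)).comp ((Ext.mk₀ (rightMul R S ω t)).comp e (zero_add i))
        (zero_add i)
    rw [rightMul_mul, Ext.mk₀_comp_mk₀_assoc]
  smul_zero s := Ext.comp_zero _ _ _ _ _
  smul_add s e e' := Ext.comp_add _ _ _ _
  add_smul s t e := by
    change (Ext.mk₀ (rightMul R S ω (s + t))).comp e (zero_add i) =
      (Ext.mk₀ (rightMul R S ω s)).comp e (zero_add i) +
        (Ext.mk₀ (rightMul R S ω t)).comp e (zero_add i)
    rw [rightMul_add, Ext.mk₀_add, Ext.add_comp]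
  zero_smul e := by
    change (Ext.mk₀ (rightMul R S ω 0)).comp e (zero_add i) = 0
    rw [rightMul_zero, Ext.mk₀_zero, Ext.zero_comp]

/-- `Ext^i_R(ω, M)` as a left `S`-module. -/
def extModule (i : ℕ) (M : ModuleCat.{u} R) : ModuleCat.{u} S :=
  letI := extModuleStructure R S ω i M
  ModuleCat.of S (Ext (ModuleCat.of R ω) M i)

/-- `Ext^i_R(ω, f)`, as a morphism of left `S`-modules. -/
def extModuleMap (i : ℕ) {U M : ModuleCat.{u} R} (f : U ⟶ M) :
    extModule R S ω i U ⟶ extModule R S ω i M :=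
  letI := extModuleStructure R S ω i U
  letI := extModuleStructure R S ω i M
  ModuleCat.ofHom
    { toFun := fun e : Ext (ModuleCat.of R ω) U i => e.comp (Ext.mk₀ f) (add_zero i)
      map_add' := fun _ _ => Ext.add_comp _ _ _ _
      map_smul' := fun _ _ => Ext.comp_assoc_of_third_deg_zero _ _ _ _ }

end ExtModule

end OmegaApprox

end

/-! The construction is a dimension shift. Embed `M` in an injective `I` with cokernel `C`, so that
`Ext^i(ω, C) ≅ Ext^{i+1}(ω, M)` for `i ≥ 1`, and take by induction on `n` an approximation `f₁ : U₁
→ C`. Cover the pullback of `f₁` and `I → C` by a direct sum `W` of copies of `ω`, one for each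
morphism from `ω`; let `U` be the kernel of `W → U₁` and `f : U → M` the map induced by `W → I`. If
`Hom(ω, f₁)` is onto, the cokernel of `Hom(ω, W) → Hom(ω, U₁)` is `Ext¹(ω, M)`. It is also `Ext¹(ω,
U)`, because `Ext^i(ω, W) = 0` for `i ≥ 1`; in higher degrees connecting maps reduce `f` to `f₁`.

The crux is that `W → U₁` is epi. This follows from `ω ⊗ Ext¹(ω, M) = 0` once the counit `ω ⊗ Hom(ω,
U₁) → U₁` is epi. The induction therefore carries a level `k` of good behaviour of the counit
(`HomApproximable`): level `k` for `U` needs level `k + 1` for `U₁`, and this is affordable because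
passing from `M` to `C` lowers the degree of Ext by one while its cograde stays the same.

Tor and the counit are only tested by maps to injective modules `J`: by adjunction, vanishing of
`Tor_j(ω, N)` for `j < k` gives vanishing of `Ext^j(N, Hom(ω, J))`
(`extVanishesBelow_of_le_torCograde`). The inductive step rests on `HomApproximable.of_shortExact`
and `epi_of_extVanishesBelow`; the induction is `exists_approximation`. -/

noncomputable section

namespace OmegaApprox

open scoped TensorProduct

/-! ### Ext along four-term exact sequences `0 → K → A → N → E → 0` -/

section ExactSequences

variable {S : Type u} [Ring S] {K A N E Y : ModuleCat.{u} S}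

theorem shortExact_moduleCat_mk {X₁ X₂ X₃ : ModuleCat.{u} S} (f : X₁ ⟶ X₂) (g : X₂ ⟶ X₃)
    (w : f ≫ g = 0) (hf : Function.Injective f.hom) (hfg : Function.Exact f.hom g.hom)
    (hg : Function.Surjective g.hom) : (ShortComplex.mk f g w).ShortExact where
  exact := (ShortComplex.ShortExact.moduleCat_exact_iff_function_exact _).2 hfg
  mono_f := (ModuleCat.mono_iff_injective _).2 hf
  epi_g := (ModuleCat.epi_iff_surjective _).2 hg

theorem subsingleton_ext_left {T : ShortComplex (ModuleCat.{u} S)} (hT : T.ShortExact) (j : ℕ)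
    (h₂ : Subsingleton (Ext T.X₂ Y j)) (h₃ : Subsingleton (Ext T.X₃ Y (j + 1))) :
    Subsingleton (Ext T.X₁ Y j) := by
  refine subsingleton_of_forall_eq 0 fun x => ?_
  obtain ⟨y, rfl⟩ := Ext.contravariant_sequence_exact₁ hT Y x (add_comm 1 j)
    (Subsingleton.elim _ _)
  rw [Subsingleton.elim y 0, Ext.comp_zero]

theorem exists_extension {T : ShortComplex (ModuleCat.{u} S)} (hT : T.ShortExact)
    (h₃ : Subsingleton (Ext T.X₃ Y 1)) (a : T.X₁ ⟶ Y) : ∃ b : T.X₂ ⟶ Y, T.f ≫ b = a := by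
  obtain ⟨y, hy⟩ := Ext.contravariant_sequence_exact₁ hT Y (Ext.mk₀ a) (add_zero 1)
    (Subsingleton.elim _ _)
  obtain ⟨b, rfl⟩ := (Ext.mk₀_bijective _ _).2 y
  exact ⟨b, (Ext.mk₀_bijective _ _).1 (by rw [← hy, Ext.mk₀_comp_mk₀])⟩

variable (ι : K ⟶ A) (φ : A ⟶ N) (q : N ⟶ E)

/-- The short exact sequence `0 → K → A → im φ → 0`. -/
theorem shortExact_rangeRestrict (hι : Function.Injective ι.hom)
    (hιφ : Function.Exact ι.hom φ.hom) :
    (ShortComplex.mk ι (ModuleCat.ofHom φ.hom.rangeRestrict) (by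
      ext x
      exact hιφ.apply_apply_eq_zero x)).ShortExact :=
  shortExact_moduleCat_mk _ _ _ hι (fun x => by
    rw [← hιφ x]
    exact Subtype.ext_iff) φ.hom.surjective_rangeRestrict

/-- The short exact sequence `0 → im φ → N → E → 0`. -/
theorem shortExact_range_subtype (hφq : Function.Exact φ.hom q.hom)
    (hq : Function.Surjective q.hom) :
    (ShortComplex.mk (ModuleCat.ofHom (LinearMap.range φ.hom).subtype) q (by
      ext ⟨_, x, rfl⟩
      exact hφq.apply_apply_eq_zero x)).ShortExact :=
  shortExact_moduleCat_mk _ _ _ Subtype.val_injective (fun x => by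
    rw [hφq x]
    simp) hq

/-- Split the sequence at the image of `φ`; each half shifts the degree by one. The three lemmas
that follow use the same splitting in low degrees. -/
theorem subsingleton_ext_of_exact_four (hι : Function.Injective ι.hom)
    (hιφ : Function.Exact ι.hom φ.hom) (hφq : Function.Exact φ.hom q.hom)
    (hq : Function.Surjective q.hom) (j : ℕ) (hA : Subsingleton (Ext A Y j))
    (hN : Subsingleton (Ext N Y (j + 1))) (hE : Subsingleton (Ext E Y (j + 2))) :
    Subsingleton (Ext K Y j) :=
  subsingleton_ext_left (shortExact_rangeRestrict ι φ hι hιφ) j hA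
    (subsingleton_ext_left (shortExact_range_subtype φ q hφq hq) (j + 1) hN hE)

theorem exists_extension_of_exact_four (hι : Function.Injective ι.hom)
    (hιφ : Function.Exact ι.hom φ.hom) (hφq : Function.Exact φ.hom q.hom)
    (hq : Function.Surjective q.hom)
    (hN : Subsingleton (Ext N Y 1)) (hE : Subsingleton (Ext E Y 2)) (a : K ⟶ Y) :
    ∃ b : A ⟶ Y, ι ≫ b = a :=
  exists_extension (shortExact_rangeRestrict ι φ hι hιφ)
    (subsingleton_ext_left (shortExact_range_subtype φ q hφq hq) 1 hN hE) a

theorem exists_factorization_of_exact_four (hι : Function.Injective ι.hom)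
    (hιφ : Function.Exact ι.hom φ.hom) (hφq : Function.Exact φ.hom q.hom)
    (hq : Function.Surjective q.hom) (hE : Subsingleton (Ext E Y 1)) (a : A ⟶ Y)
    (ha : ι ≫ a = 0) : ∃ b : N ⟶ Y, φ ≫ b = a := by
  have hS := shortExact_rangeRestrict ι φ hι hιφ
  have := hS.epi_g
  obtain ⟨b, hb⟩ := exists_extension (shortExact_range_subtype φ q hφq hq) hE
    (hS.exact.desc a ha)
  refine ⟨b, ?_⟩
  rw [← hS.exact.g_desc a ha, ← hb]
  rfl

theorem eq_zero_of_comp_eq_zero_of_exact (hφq : Function.Exact φ.hom q.hom)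
    (hq : Function.Surjective q.hom) (hE : Subsingleton (Ext E Y 0)) (b : N ⟶ Y)
    (hb : φ ≫ b = 0) : b = 0 := by
  have hS := shortExact_range_subtype φ q hφq hq
  have := hS.epi_g
  have hb' : ModuleCat.ofHom (LinearMap.range φ.hom).subtype ≫ b = 0 := by
    ext ⟨_, x, rfl⟩
    exact ConcreteCategory.congr_hom hb x
  rw [← hS.exact.g_desc b hb', (Ext.mk₀_bijective _ _).1 (Subsingleton.elim
    (Ext.mk₀ (hS.exact.desc b hb')) (Ext.mk₀ 0)), Limits.comp_zero]

end ExactSequences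

/-! ### `Ext^i_R(ω, -)` as a functor to `S`-modules, and its connecting maps -/

section HomModule

variable (R S : Type u) [Ring R] [Ring S] (ω : Type u) [AddCommGroup ω]
  [Module R ω] [Module Sᵐᵒᵖ ω] [SMulCommClass Sᵐᵒᵖ R ω]

/-- The functor `Ext^i_R(ω, -)` with values in left `S`-modules. -/
def extModuleFunctor (i : ℕ) : ModuleCat.{u} R ⥤ ModuleCat.{u} S where
  obj M := extModule R S ω i M
  map f := extModuleMap R S ω i f
  map_id M := by
    ext e
    exact Ext.comp_mk₀_id e
  map_comp {L M N} f g := by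
    refine ModuleCat.hom_ext (LinearMap.ext fun e : Ext (ModuleCat.of R ω) L i => ?_)
    change e.comp (Ext.mk₀ (f ≫ g)) (add_zero i) =
      (e.comp (Ext.mk₀ f) (add_zero i)).comp (Ext.mk₀ g) (add_zero i)
    rw [Ext.comp_assoc_of_second_deg_zero, Ext.mk₀_comp_mk₀]

instance (i : ℕ) : (extModuleFunctor R S ω i).Additive where
  map_add {M N f g} := by
    refine ModuleCat.hom_ext (LinearMap.ext fun e : Ext (ModuleCat.of R ω) M i => ?_)
    change e.comp (Ext.mk₀ (f + g)) (add_zero i) =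
      e.comp (Ext.mk₀ f) (add_zero i) + e.comp (Ext.mk₀ g) (add_zero i)
    rw [Ext.mk₀_add, Ext.comp_add]

variable {R ω}

/-- A morphism `ω ⟶ M`, as an element of `Hom_R(ω, M) = Ext^0_R(ω, M)`. -/
def homMk {M : ModuleCat.{u} R} : (ModuleCat.of R ω ⟶ M) ≃+ (extModuleFunctor R S ω 0).obj M :=
  Ext.addEquiv₀.symm

theorem smul_homMk {M : ModuleCat.{u} R} (s : S) (a : ModuleCat.of R ω ⟶ M) :
    s • homMk S a = homMk S (rightMul R S ω s ≫ a) :=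
  Ext.mk₀_comp_mk₀ _ _

theorem extModuleFunctor_map_homMk {M N : ModuleCat.{u} R} (f : M ⟶ N)
    (a : ModuleCat.of R ω ⟶ M) :
    ((extModuleFunctor R S ω 0).map f).hom (homMk S a) = homMk S (a ≫ f) :=
  Ext.mk₀_comp_mk₀ _ _

theorem homMk_symm_smul {M : ModuleCat.{u} R} (s : S) (e : (extModuleFunctor R S ω 0).obj M) (x : ω) :
    ((homMk S).symm (s • e)).hom x = ((homMk S).symm e).hom (MulOpposite.op s • x) := by
  obtain ⟨a, rfl⟩ := (homMk S).surjective e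
  rw [smul_homMk]
  simp [rightMul]

theorem extModuleFunctor_zero_map_injective {M N : ModuleCat.{u} R} (f : M ⟶ N)
    (hf : Function.Injective f.hom) :
    Function.Injective ((extModuleFunctor R S ω 0).map f).hom := by
  have := (ModuleCat.mono_iff_injective f).2 hf
  intro x y hxy
  obtain ⟨a, rfl⟩ := (homMk S).surjective x
  obtain ⟨b, rfl⟩ := (homMk S).surjective y
  rw [extModuleFunctor_map_homMk, extModuleFunctor_map_homMk] at hxy
  rw [(cancel_mono f).1 ((homMk S).injective hxy)]

/-- The connecting homomorphism `Ext^i_R(ω, T₃) → Ext^{i+1}_R(ω, T₁)`, as an `S`-linear map. -/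
def extConnecting {T : ShortComplex (ModuleCat.{u} R)} (hT : T.ShortExact) (i : ℕ) :
    (extModuleFunctor R S ω i).obj T.X₃ ⟶ (extModuleFunctor R S ω (i + 1)).obj T.X₁ :=
  letI := extModuleStructure R S ω i T.X₃
  letI := extModuleStructure R S ω (i + 1) T.X₁
  ModuleCat.ofHom
    { toFun := fun e : Ext (ModuleCat.of R ω) T.X₃ i => e.comp hT.extClass rfl
      map_add' := fun _ _ => Ext.add_comp _ _ _ _
      map_smul' := fun _ _ => Ext.comp_assoc _ _ _ _ _ (by lia) }

variable {S} in
theorem extConnecting_naturality {T T' : ShortComplex (ModuleCat.{u} R)} (hT : T.ShortExact)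
    (hT' : T'.ShortExact) (f : T ⟶ T') (i : ℕ) (e : Ext (ModuleCat.of R ω) T.X₃ i) :
    ((extModuleFunctor R S ω (i + 1)).map f.τ₁).hom ((extConnecting S hT i).hom e) =
      (extConnecting S hT' i).hom (((extModuleFunctor R S ω i).map f.τ₃).hom e) := by
  change (e.comp hT.extClass rfl).comp (Ext.mk₀ f.τ₁) (add_zero _) =
    (e.comp (Ext.mk₀ f.τ₃) (add_zero _)).comp hT'.extClass rfl
  rw [Ext.comp_assoc_of_third_deg_zero, ShortComplex.ShortExact.extClass_naturality hT hT' f,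
    Ext.comp_assoc_of_second_deg_zero]

variable {S} in
theorem exact_extConnecting {T : ShortComplex (ModuleCat.{u} R)} (hT : T.ShortExact) (i : ℕ) :
    Function.Exact ((extModuleFunctor R S ω i).map T.g).hom (extConnecting S hT i).hom := by
  intro e
  constructor
  · intro he
    exact Ext.covariant_sequence_exact₃ _ hT e rfl he
  · rintro ⟨e : Ext (ModuleCat.of R ω) T.X₂ i, rfl⟩
    change (e.comp (Ext.mk₀ T.g) (add_zero _)).comp hT.extClass rfl = 0
    rw [Ext.comp_assoc_of_second_deg_zero, hT.comp_extClass, Ext.comp_zero]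

variable {S} in
theorem extConnecting_surjective {T : ShortComplex (ModuleCat.{u} R)} (hT : T.ShortExact) (i : ℕ)
    (h : Subsingleton (Ext (ModuleCat.of R ω) T.X₂ (i + 1))) :
    Function.Surjective (extConnecting (ω := ω) S hT i).hom := fun e =>
  Ext.covariant_sequence_exact₁ _ hT e (Subsingleton.elim _ _) rfl

variable {S} in
theorem extConnecting_bijective {T : ShortComplex (ModuleCat.{u} R)} (hT : T.ShortExact) (i : ℕ)
    (h : Subsingleton (Ext (ModuleCat.of R ω) T.X₂ i))
    (h' : Subsingleton (Ext (ModuleCat.of R ω) T.X₂ (i + 1))) :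
    Function.Bijective (extConnecting (ω := ω) S hT i).hom := by
  refine ⟨(injective_iff_map_eq_zero _).2 fun e he => ?_, extConnecting_surjective hT i h'⟩
  obtain ⟨y, rfl⟩ := (exact_extConnecting hT i e).1 he
  have : y = 0 := Subsingleton.elim (α := Ext (ModuleCat.of R ω) T.X₂ i) _ _
  rw [this, map_zero]

end HomModule

/-! ### Direct sums of copies of `ω` -/

section CopowerOfOmega

variable (R S : Type u) [Ring R] [Ring S] (ω : Type u) [AddCommGroup ω]
  [Module R ω] [Module Sᵐᵒᵖ ω] [SMulCommClass Sᵐᵒᵖ R ω]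

-- A map that kills a component on finitely many generators kills it altogether. Hence finitely
-- generated modules see only finitely many summands of `ω^(X)`.
variable {R ω} in
theorem finite_setOf_lapply_comp_ne_zero {F X : Type*} [AddCommGroup F] [Module R F]
    [Module.Finite R F] (a : F →ₗ[R] X →₀ ω) : {x | Finsupp.lapply x ∘ₗ a ≠ 0}.Finite := by
  classical
  obtain ⟨t, ht⟩ := Module.Finite.fg_top (R := R) (M := F)
  refine (t.biUnion fun y => (a y).support).finite_toSet.subset fun x hx => ?_
  by_contra hxt
  refine hx (LinearMap.ext_on ht fun y hy => ?_)
  by_contra hxy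
  exact hxt (by simpa using ⟨y, hy, hxy⟩)

/-- The direct sum `ω^(X)`. -/
abbrev copower (X : Type u) : ModuleCat.{u} R := ModuleCat.of R (X →₀ ω)

variable {R ω}

/-- The inclusion of a summand. -/
def copowerι {X : Type u} (x : X) : ModuleCat.of R ω ⟶ copower R ω X :=
  ModuleCat.ofHom (Finsupp.lsingle x)

/-- The projection to a summand. -/
def copowerπ {X : Type u} (x : X) : copower R ω X ⟶ ModuleCat.of R ω :=
  ModuleCat.ofHom (Finsupp.lapply x)

theorem copowerι_π_self {X : Type u} (x : X) :
    copowerι (R := R) (ω := ω) x ≫ copowerπ x = 𝟙 _ := by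
  ext y
  simp [copowerι, copowerπ]

theorem copowerι_π_of_ne {X : Type u} {x y : X} (h : x ≠ y) :
    copowerι (R := R) (ω := ω) x ≫ copowerπ y = 0 := by
  ext z
  simp [copowerι, copowerπ, h]

theorem copower_hom_ext {X : Type u} {Y : ModuleCat.{u} R} {f g : copower R ω X ⟶ Y}
    (h : ∀ x, copowerι x ≫ f = copowerι x ≫ g) : f = g :=
  ModuleCat.hom_ext (Finsupp.lhom_ext' fun x => congrArg ModuleCat.Hom.hom (h x))

theorem hom_copower_ext {X : Type u} {Y : ModuleCat.{u} R} {f g : Y ⟶ copower R ω X}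
    (h : ∀ x, f ≫ copowerπ x = g ≫ copowerπ x) : f = g := by
  ext y x
  exact ConcreteCategory.congr_hom (h x) y

/-- The morphism out of `ω^(X)` given by a family of morphisms out of `ω`. -/
def copowerDesc {X : Type u} {Y : ModuleCat.{u} R} (a : X → (ModuleCat.of R ω ⟶ Y)) :
    copower R ω X ⟶ Y :=
  ModuleCat.ofHom (Finsupp.lsum ℕ fun x => (a x).hom)

theorem copowerι_desc {X : Type u} {Y : ModuleCat.{u} R} (a : X → (ModuleCat.of R ω ⟶ Y))
    (x : X) : copowerι x ≫ copowerDesc a = a x := by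
  ext y
  simp [copowerι, copowerDesc]

/-- A cocycle is a coboundary in each component, and it has only finitely many nonzero components
because the term of the resolution is finitely generated. -/
theorem subsingleton_ext_copower {Z : ModuleCat.{u} R} (hZ : HasDegreewiseFiniteResolution R Z)
    (X : Type u) (i : ℕ) (h : Subsingleton (Ext Z (ModuleCat.of R ω) (i + 1))) :
    Subsingleton (Ext Z (copower R ω X) (i + 1)) := by
  classical
  obtain ⟨P, hP⟩ := hZ
  have := hP (i + 1)
  refine subsingleton_of_forall_eq 0 fun e => ?_
  obtain ⟨a, ha, rfl⟩ := P.extMk_surjective e _ rfl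
  rw [P.extMk_eq_zero_iff _ _ _ _ i rfl]
  have hb (x : X) : ∃ b : P.complex.X i ⟶ ModuleCat.of R ω,
      P.complex.d (i + 1) i ≫ b = a ≫ copowerπ x :=
    (P.extMk_eq_zero_iff (a ≫ copowerπ x) _ rfl (by rw [reassoc_of% ha, Limits.zero_comp]) i
      rfl).1 (Subsingleton.elim _ _)
  choose b hb using hb
  have hfin := finite_setOf_lapply_comp_ne_zero a.hom
  -- Where the component of `a` is zero, the chosen `b x` is discarded; this keeps the sum finite.
  refine ⟨∑ x ∈ hfin.toFinset, b x ≫ copowerι x, hom_copower_ext fun y => ?_⟩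
  rw [Preadditive.comp_sum, Preadditive.sum_comp]
  simp_rw [reassoc_of% hb, Category.assoc]
  rw [Finset.sum_eq_single y]
  · rw [copowerι_π_self, Category.comp_id]
  · intro x _ hxy
    rw [copowerι_π_of_ne hxy, Limits.comp_zero, Limits.comp_zero]
  · intro hy
    rw [copowerι_π_self, Category.comp_id]
    by_contra hne
    exact hy (hfin.mem_toFinset.2 fun h0 => hne (ModuleCat.hom_ext h0))

variable {S}

theorem rightMul_bijective
    (h : Function.Bijective fun s : S => Module.toModuleEnd (S := Sᵐᵒᵖ) R ω (MulOpposite.op s)) :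
    Function.Bijective (rightMul R S ω) :=
  (ModuleCat.homEquiv (R := R) (M := .of R ω) (N := .of R ω)).symm.bijective.comp h

variable (R S ω)

/-- The `S`-linear map from the free module on `X` to `Hom_R(ω, ω^(X))`. -/
def homCopowerMap (X : Type u) : (X →₀ S) →ₗ[S] (extModuleFunctor R S ω 0).obj (copower R ω X) :=
  Finsupp.linearCombination S fun x => homMk S (copowerι x)

variable {R S ω}

theorem map_copowerπ_homCopowerMap {X : Type u} (f : X →₀ S) (x : X) :
    ((extModuleFunctor R S ω 0).map (copowerπ x)).hom (homCopowerMap R S ω X f) =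
      homMk S (rightMul R S ω (f x)) := by
  induction f using Finsupp.induction_linear with
  | zero => rw [map_zero, map_zero, Finsupp.zero_apply, rightMul_zero, map_zero]
  | add f g hf hg => rw [map_add, map_add, hf, hg, Finsupp.add_apply, rightMul_add, map_add]
  | single y s =>
    rw [homCopowerMap, Finsupp.linearCombination_single, map_smul, extModuleFunctor_map_homMk,
      smul_homMk]
    by_cases h : y = x
    · subst h
      rw [copowerι_π_self, Category.comp_id, Finsupp.single_eq_same]
    · rw [copowerι_π_of_ne h, Limits.comp_zero, Finsupp.single_eq_of_ne (Ne.symm h),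
        rightMul_zero]

/-- On each component this is the homothety `S → End_R(ω)`; finite generation of `ω` makes the
family of coefficients finitely supported. -/
theorem homCopowerMap_bijective [Module.Finite R ω]
    (h : Function.Bijective fun s : S => Module.toModuleEnd (S := Sᵐᵒᵖ) R ω (MulOpposite.op s))
    (X : Type u) : Function.Bijective (homCopowerMap R S ω X) := by
  have h := rightMul_bijective h
  constructor
  · intro f g hfg
    ext x
    refine h.1 ((homMk S).injective ?_)
    rw [← map_copowerπ_homCopowerMap, ← map_copowerπ_homCopowerMap, hfg]
  · intro e
    obtain ⟨a, rfl⟩ := (homMk S).surjective e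
    choose s hs using fun x => h.2 (a ≫ copowerπ x)
    have hfin := finite_setOf_lapply_comp_ne_zero a.hom
    refine ⟨Finsupp.onFinset hfin.toFinset s fun x hx => hfin.mem_toFinset.2 fun h0 => hx
      (h.1 ?_), ?_⟩
    · rw [hs, rightMul_zero]
      exact ModuleCat.hom_ext h0
    · obtain ⟨b, hb⟩ := (homMk S).surjective (homCopowerMap R S ω X
        (Finsupp.onFinset hfin.toFinset s fun x hx => hfin.mem_toFinset.2 fun h0 => hx
          (h.1 (by rw [hs, rightMul_zero]; exact ModuleCat.hom_ext h0))))
      rw [← hb]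
      congr 1
      refine hom_copower_ext fun x => (homMk S).injective ?_
      rw [← extModuleFunctor_map_homMk, hb, map_copowerπ_homCopowerMap, Finsupp.onFinset_apply, hs]

theorem projective_hom_copower [Module.Finite R ω]
    (h : Function.Bijective fun s : S => Module.toModuleEnd (S := Sᵐᵒᵖ) R ω (MulOpposite.op s))
    (X : Type u) : Projective ((extModuleFunctor R S ω 0).obj (copower R ω X)) := by
  have := Module.Projective.of_equiv (LinearEquiv.ofBijective _ (homCopowerMap_bijective h X))
  exact ModuleCat.projective_of_categoryTheory_projective _

/-- Since `Hom(ω, ω^(X))` is free on the inclusions of the summands, both sides amount to families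
of morphisms `ω ⟶ Y` indexed by `X`. -/
theorem map_hom_copower_bijective [Module.Finite R ω]
    (h : Function.Bijective fun s : S => Module.toModuleEnd (S := Sᵐᵒᵖ) R ω (MulOpposite.op s))
    (X : Type u) (Y : ModuleCat.{u} R) : Function.Bijective
      fun g : copower R ω X ⟶ Y => (extModuleFunctor R S ω 0).map g := by
  constructor
  · intro f g hfg
    refine copower_hom_ext fun x => (homMk S).injective ?_
    rw [← extModuleFunctor_map_homMk, ← extModuleFunctor_map_homMk]
    exact ConcreteCategory.congr_hom hfg _
  · intro ψ
    refine ⟨copowerDesc fun x => (homMk S).symm (ψ.hom (homMk S (copowerι x))),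
      ModuleCat.hom_ext (LinearMap.cancel_right (homCopowerMap_bijective h X).2 |>.1
        (Finsupp.lhom_ext' fun x => LinearMap.ext_ring ?_))⟩
    have : homCopowerMap R S ω X (Finsupp.single x 1) = homMk S (copowerι x) := by
      rw [homCopowerMap, Finsupp.linearCombination_single, one_smul]
    rw [LinearMap.comp_apply, LinearMap.comp_apply, LinearMap.comp_apply, LinearMap.comp_apply,
      Finsupp.lsingle_apply, this, extModuleFunctor_map_homMk, copowerι_desc, AddEquiv.apply_symm_apply]

end CopowerOfOmega

/-! ### Universal property of `ω ⊗_S N` -/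

section Tensor

variable (R S : Type u) [Ring R] [Ring S] (ω : Type u) [AddCommGroup ω]
  [Module R ω] [Module Sᵐᵒᵖ ω]

/-- The class of `x ⊗ y` in `ω ⊗_S N`. -/
def balancedMk (N : Type u) [AddCommGroup N] [Module S N] (x : ω) (y : N) :
    BalancedTensor R S ω N := Submodule.Quotient.mk (x ⊗ₜ[ℤ] y)

variable {R S ω} {N : Type u} [AddCommGroup N] [Module S N]

theorem balancedMk_smul (x : ω) (s : S) (y : N) :
    balancedMk R S ω N (MulOpposite.op s • x) y = balancedMk R S ω N x (s • y) :=
  (Submodule.Quotient.eq _).2 (Submodule.subset_span ⟨x, s, y, rfl⟩)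

theorem smul_balancedMk (x : ω) (r : R) (y : N) :
    r • balancedMk R S ω N x y = balancedMk R S ω N (r • x) y := rfl

theorem balancedMk_add_left (x x' : ω) (y : N) : balancedMk R S ω N (x + x') y =
    balancedMk R S ω N x y + balancedMk R S ω N x' y := by
  rw [balancedMk, TensorProduct.add_tmul]; rfl

theorem balancedMk_add_right (x : ω) (y y' : N) : balancedMk R S ω N x (y + y') =
    balancedMk R S ω N x y + balancedMk R S ω N x y' := by
  rw [balancedMk, TensorProduct.tmul_add]; rfl

/-- The linear map out of `ω ⊗_S N` given by a balanced biadditive map. -/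
def balancedLift {Y : Type u} [AddCommGroup Y] [Module R Y] (b : N →+ (ω →ₗ[R] Y))
    (hb : ∀ (s : S) (y : N) (x : ω), b (s • y) x = b y (MulOpposite.op s • x)) :
    BalancedTensor R S ω N →ₗ[R] Y :=
  Submodule.liftQ _ (TensorProduct.AlgebraTensorModule.lift (R := ℤ) (A := R)
    { toFun := fun x => (((LinearMap.applyₗ' ℤ x : (ω →ₗ[R] Y) →ₗ[ℤ] Y).toAddMonoidHom).comp
        b).toIntLinearMap
      map_add' := fun x x' => by ext; simp
      map_smul' := fun r x => by ext; simp }) (Submodule.span_le.2 (by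
        rintro _ ⟨x, s, y, rfl⟩
        simp [hb]))

theorem balancedLift_mk {Y : Type u} [AddCommGroup Y] [Module R Y] (b : N →+ (ω →ₗ[R] Y))
    (hb : ∀ (s : S) (y : N) (x : ω), b (s • y) x = b y (MulOpposite.op s • x)) (x : ω) (y : N) :
    balancedLift b hb (balancedMk R S ω N x y) = b y x := by
  rfl

theorem balancedTensor_hom_ext_mk {N : Type u} [AddCommGroup N] [Module S N] {P : Type u}
    [AddCommGroup P] [Module R P] {f g : BalancedTensor R S ω N →ₗ[R] P}
    (h : ∀ (x : ω) (y : N), f (balancedMk R S ω N x y) = g (balancedMk R S ω N x y)) : f = g :=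
  balancedTensor_hom_ext R S ω h

end Tensor

/-! ### Tensor-Hom adjunction, and the passage from Tor to Ext -/

section TensorHom

variable {R S : Type u} [Ring R] [Ring S] {ω : Type u} [AddCommGroup ω]
  [Module R ω] [Module Sᵐᵒᵖ ω] [SMulCommClass Sᵐᵒᵖ R ω]

theorem omegaProjective_copower (X : Type u) :
    omegaProjective R S ω (copower R ω X) := by
  classical
  let b : (X →₀ S) →+ (ω →ₗ[R] X →₀ ω) := Finsupp.liftAddHom fun x =>
    { toFun := fun s => Finsupp.lsingle x ∘ₗ Module.toModuleEnd (S := Sᵐᵒᵖ) R ω (MulOpposite.op s)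
      map_zero' := by ext; simp
      map_add' := fun s t => by ext; simp [add_smul] }
  have hbs (x : X) (s : S) (w : ω) :
      b (Finsupp.single x s) w = Finsupp.single x (MulOpposite.op s • w) := by simp [b]
  have hb (s : S) (f : X →₀ S) (w : ω) : b (s • f) w = b f (MulOpposite.op s • w) := by
    induction f using Finsupp.induction_linear with
    | zero => simp
    | add f g hf hg => simp only [smul_add, map_add, LinearMap.add_apply, hf, hg]
    | single x t => rw [Finsupp.smul_single, hbs, hbs, smul_smul, smul_eq_mul, MulOpposite.op_mul]
  let a (x : X) : ω →ₗ[R] BalancedTensor R S ω (X →₀ S) :=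
    { toFun := fun w => balancedMk R S ω _ w (Finsupp.single x 1)
      map_add' := fun w w' => balancedMk_add_left w w' _
      map_smul' := fun r w => (smul_balancedMk w r _).symm }
  refine ⟨ModuleCat.of S (X →₀ S), inferInstanceAs (Module.Projective S (X →₀ S)), ⟨?_⟩⟩
  refine LinearEquiv.toModuleIso (LinearEquiv.ofLinearMap (Finsupp.lsum ℕ a) (balancedLift b hb)
    (balancedTensor_hom_ext_mk fun w f => ?_) (Finsupp.lhom_ext fun x w => ?_))
  · rw [LinearMap.comp_apply, balancedLift_mk, LinearMap.id_apply]
    induction f using Finsupp.induction_linear with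
    | zero =>
      rw [map_zero, LinearMap.zero_apply, map_zero]
      have : balancedMk R S ω (X →₀ S) w 0 = 0 := by
        simpa using balancedMk_add_right (R := R) (S := S) w (0 : X →₀ S) 0
      exact this.symm
    | add f g hf hg => rw [map_add, LinearMap.add_apply, map_add, hf, hg, balancedMk_add_right]
    | single x s =>
      rw [hbs, Finsupp.lsum_single]
      refine (balancedMk_smul w s (Finsupp.single x 1)).trans ?_
      rw [Finsupp.smul_single, smul_eq_mul, mul_one]
  · rw [LinearMap.comp_apply, Finsupp.lsum_single]
    refine (balancedLift_mk b hb w (Finsupp.single x 1)).trans ?_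
    rw [hbs, MulOpposite.op_one, one_smul, LinearMap.id_apply]

/-- The morphism `ω ⊗_S N ⟶ J` adjoint to a morphism `N ⟶ Hom_R(ω, J)`. -/
def tensorLift {N : ModuleCat.{u} S} {J : ModuleCat.{u} R}
    (a : N ⟶ (extModuleFunctor R S ω 0).obj J) : (tensorFunctor R S ω).obj N ⟶ J :=
  ModuleCat.ofHom (balancedLift (((ModuleCat.homAddEquiv (R := R)).toAddMonoidHom.comp
    (homMk S).symm.toAddMonoidHom).comp a.hom.toAddMonoidHom) fun s y x => by
      simp only [AddMonoidHom.comp_apply, LinearMap.toAddMonoidHom_coe, map_smul]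
      exact homMk_symm_smul S s _ x)

theorem tensorLift_mk {N : ModuleCat.{u} S} {J : ModuleCat.{u} R}
    (a : N ⟶ (extModuleFunctor R S ω 0).obj J) (x : ω) (y : N) :
    (tensorLift a).hom (balancedMk R S ω N x y) = ((homMk S).symm (a.hom y)).hom x := rfl

theorem map_comp_tensorLift {N N' : ModuleCat.{u} S} {J : ModuleCat.{u} R} (d : N ⟶ N')
    (a : N' ⟶ (extModuleFunctor R S ω 0).obj J) :
    (tensorFunctor R S ω).map d ≫ tensorLift a = tensorLift (d ≫ a) :=
  ModuleCat.hom_ext (balancedTensor_hom_ext_mk fun _ _ => rfl)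

theorem tensorLift_injective {N : ModuleCat.{u} S} {J : ModuleCat.{u} R} :
    Function.Injective (tensorLift (ω := ω) (N := N) (J := J)) := by
  intro a b hab
  ext y
  refine (homMk S).symm.injective (ModuleCat.hom_ext (LinearMap.ext fun x => ?_))
  rw [← tensorLift_mk, ← tensorLift_mk, hab]

theorem tensorLift_surjective {N : ModuleCat.{u} S} {J : ModuleCat.{u} R} :
    Function.Surjective (tensorLift (ω := ω) (N := N) (J := J)) := by
  intro g
  let c (y : N) : ModuleCat.of R ω ⟶ J := ModuleCat.ofHom
    { toFun := fun x => g.hom (balancedMk R S ω N x y)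
      map_add' := fun x x' => by rw [balancedMk_add_left]; exact map_add g.hom _ _
      map_smul' := fun r x => by rw [← smul_balancedMk]; exact map_smul g.hom _ _ }
  let a : N →ₗ[S] (extModuleFunctor R S ω 0).obj J :=
    { toFun := fun y => homMk S (c y)
      map_add' := fun y y' => by
        rw [← map_add]
        congr 1
        ext x
        exact (congrArg g.hom (balancedMk_add_right x y y')).trans (map_add g.hom _ _)
      map_smul' := fun s y => by
        rw [RingHom.id_apply, smul_homMk]
        congr 1
        ext x
        exact congrArg g.hom (balancedMk_smul x s y).symm }
  refine ⟨ModuleCat.ofHom (Y := (extModuleFunctor R S ω 0).obj J) a, ModuleCat.hom_ext (balancedTensor_hom_ext_mk fun x y => ?_)⟩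
  refine (tensorLift_mk _ x y).trans ?_
  change ((homMk S).symm (homMk S (c y))).hom x = _
  rw [AddEquiv.symm_apply_apply]
  rfl

theorem tensorLift_zero {N : ModuleCat.{u} S} {J : ModuleCat.{u} R} :
    tensorLift (0 : N ⟶ (extModuleFunctor R S ω 0).obj J) = 0 :=
  ModuleCat.hom_ext (balancedTensor_hom_ext_mk fun x y =>
    (tensorLift_mk _ x y).trans (by simp; rfl))

variable (R ω) in
/-- All `Ext^j_S(N, Hom_R(ω, J))` with `J` injective and `j < k` vanish: this is dual to the
vanishing of all `Tor_j^S(ω, N)` with `j < k`. -/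
def ExtVanishesBelow (k : ℕ) (N : ModuleCat.{u} S) : Prop :=
  ∀ (J : ModuleCat.{u} R), Injective J → ∀ j < k,
    Subsingleton (Ext N ((extModuleFunctor R S ω 0).obj J) j)

theorem ExtVanishesBelow.of_iso {k : ℕ} {N N' : ModuleCat.{u} S} (h : ExtVanishesBelow R ω k N)
    (e : N' ≅ N) : ExtVanishesBelow R ω k N' := by
  intro J hJ j hj
  have := h J hJ j hj
  refine subsingleton_of_forall_eq 0 fun x => ?_
  rw [← Ext.mk₀_id_comp x, ← e.hom_inv_id, ← Ext.mk₀_comp_mk₀_assoc,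
    Subsingleton.elim ((Ext.mk₀ e.inv).comp x (zero_add j)) 0, Ext.comp_zero]

/-- For a projective resolution `P` of `N`, the adjunction turns a cocycle `P_j → Hom(ω, J)` into a
map `ω ⊗ P_j → J` vanishing on the image of `ω ⊗ P_{j+1}`. Exactness at `j`, which is `Tor_j = 0`,
and injectivity of `J` factor it through `ω ⊗ P_{j-1}`, which makes the cocycle a coboundary. -/
theorem extVanishesBelow_of_le_torCograde {k : ℕ} {N : ModuleCat.{u} S}
    (h : (k : ℕ∞) ≤ torCograde R S ω N) : ExtVanishesBelow R ω k N := by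
  intro J hJ j hj
  have hTor : Subsingleton (torModule R S ω j N) := by
    by_contra hne
    have := h.trans (iInf₂_le j hne)
    exact absurd (Nat.cast_le.1 this) (by lia)
  let P := projectiveResolution N
  have hexact : (((tensorFunctor R S ω).mapHomologicalComplex _).obj P.complex).ExactAt j := by
    rw [HomologicalComplex.exactAt_iff_isZero_homology]
    exact (ModuleCat.isZero_of_subsingleton (torModule R S ω j N)).of_iso
      (P.isoLeftDerivedObj (tensorFunctor R S ω) j).symm
  refine subsingleton_of_forall_eq 0 fun e => ?_
  obtain ⟨f, hf, rfl⟩ := P.extMk_surjective e _ rfl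
  have hlift : (tensorFunctor R S ω).map (P.complex.d (j + 1) j) ≫ tensorLift f = 0 := by
    rw [map_comp_tensorLift, hf, tensorLift_zero]
  -- In degree `0` there is no `P_{j-1}`: exactness says that `ω ⊗ P_1 → ω ⊗ P_0` is epi, and the
  -- cocycle itself is zero.
  cases j with
  | zero =>
    rw [HomologicalComplex.exactAt_iff' _ 1 0 0 (by simp) (by simp)] at hexact
    have hd : (((tensorFunctor R S ω).mapHomologicalComplex _).obj P.complex).d 0 0 = 0 :=
      HomologicalComplex.shape _ _ _ (by simp)
    have hepi : Epi ((tensorFunctor R S ω).map (P.complex.d 1 0)) :=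
      hexact.epi_f hd
    have hf0 : f = 0 := tensorLift_injective (by
      rw [tensorLift_zero, ← cancel_epi ((tensorFunctor R S ω).map (P.complex.d 1 0)), hlift,
        Limits.comp_zero])
    subst hf0
    exact P.extMk_zero _ rfl
  | succ j =>
    rw [HomologicalComplex.exactAt_iff' _ (j + 2) (j + 1) j (by simp) (by simp)] at hexact
    rw [P.extMk_eq_zero_iff _ _ _ _ j rfl]
    obtain ⟨g, hg⟩ := tensorLift_surjective (hexact.descToInjective (tensorLift f) hlift)
    refine ⟨g, tensorLift_injective ?_⟩
    rw [← map_comp_tensorLift, hg]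
    exact hexact.comp_descToInjective _ _

end TensorHom

/-! ### Splicing finite coresolutions -/

section Coresolution

variable {R : Type u} [Ring R] {𝒳 : ObjectProperty (ModuleCat.{u} R)}

theorem hasCoresolutionOfLength_zero {U : ModuleCat.{u} R} (hU : 𝒳 U) :
    HasCoresolutionOfLength 𝒳 U 0 := by
  refine ⟨fun i => Nat.casesOn i U fun _ => ModuleCat.of R PUnit, 𝟙 U, fun _ => 0, ?_, ?_,
    Function.injective_id, ?_, ?_⟩
  · rintro i hi
    obtain rfl := Nat.le_zero.1 hi
    exact hU
  · rintro (_ | i) hi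
    · exact absurd hi (lt_irrefl 0)
    · exact inferInstanceAs (Subsingleton PUnit)
  · exact fun x => ⟨fun _ => ⟨x, rfl⟩, fun _ => rfl⟩
  · intro i x
    exact ⟨fun _ => ⟨0, Subsingleton.elim (α := PUnit) _ _⟩, fun _ => rfl⟩

theorem HasCoresolutionOfLength.succ {T : ShortComplex (ModuleCat.{u} R)} (hT : T.ShortExact)
    (h₂ : 𝒳 T.X₂) {n : ℕ} (h₃ : HasCoresolutionOfLength 𝒳 T.X₃ n) :
    HasCoresolutionOfLength 𝒳 T.X₁ (n + 1) := by
  obtain ⟨X, ε, d, hX, hX', hε, hε', hd⟩ := h₃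
  have hTex : Function.Exact T.f.hom T.g.hom :=
    (ShortComplex.ShortExact.moduleCat_exact_iff_function_exact _).1 hT.exact
  refine ⟨fun i => Nat.casesOn i T.X₂ X, T.f,
    fun i => Nat.rec (T.g ≫ ε : T.X₂ ⟶ X 0) (fun i _ => d i) i, ?_, ?_, hT.injective_f, ?_, ?_⟩
  · rintro (_ | i) hi
    · exact h₂
    · exact hX i (Nat.le_of_succ_le_succ hi)
  · rintro (_ | i) hi
    · exact absurd hi (Nat.not_lt_zero _)
    · exact hX' i (Nat.lt_of_succ_lt_succ hi)
  · intro x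
    rw [← hTex x]
    exact map_eq_zero_iff ε.hom hε
  · rintro (_ | i)
    · intro x
      refine (hε' x).trans ⟨?_, ?_⟩
      · rintro ⟨y, rfl⟩
        obtain ⟨z, rfl⟩ := hT.surjective_g y
        exact ⟨z, rfl⟩
      · rintro ⟨z, rfl⟩
        exact ⟨T.g z, rfl⟩
    · exact hd i

end Coresolution

/-! ### The inductive construction of the approximation -/

section Approximation

variable (R S : Type u) [Ring R] [Ring S] (ω : Type u) [AddCommGroup ω]
  [Module R ω] [Module Sᵐᵒᵖ ω] [SMulCommClass Sᵐᵒᵖ R ω]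

/-- Dually to conditions on the counit `ω ⊗_S Hom_R(ω, U) → U` (surjective if `1 ≤ k`, injective
if `2 ≤ k`) and on the vanishing of `Tor_j^S(ω, Hom_R(ω, U))` for `1 ≤ j ≤ k - 2`. -/
structure HomApproximable (k : ℕ) (U : ModuleCat.{u} R) : Prop where
  eq_zero : 1 ≤ k → ∀ J : ModuleCat.{u} R, Injective J → ∀ g : U ⟶ J,
    (extModuleFunctor R S ω 0).map g = 0 → g = 0
  exists_map_eq : 2 ≤ k → ∀ J : ModuleCat.{u} R, Injective J →
    ∀ ψ : (extModuleFunctor R S ω 0).obj U ⟶ (extModuleFunctor R S ω 0).obj J,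
      ∃ g : U ⟶ J, (extModuleFunctor R S ω 0).map g = ψ
  subsingleton_ext : ∀ J : ModuleCat.{u} R, Injective J → ∀ j : ℕ, j + 3 ≤ k → Subsingleton
    (Ext ((extModuleFunctor R S ω 0).obj U) ((extModuleFunctor R S ω 0).obj J) (j + 1))

variable {R S ω}

theorem homApproximable_copower [Module.Finite R ω]
    (h : Function.Bijective fun s : S => Module.toModuleEnd (S := Sᵐᵒᵖ) R ω (MulOpposite.op s))
    (X : Type u) (k : ℕ) : HomApproximable R S ω k (copower R ω X) where
  eq_zero _ J _ _ hg := (map_hom_copower_bijective h X J).1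
    (hg.trans ((extModuleFunctor R S ω 0).map_zero _ _).symm)
  exists_map_eq _ _ _ ψ := (map_hom_copower_bijective h X _).2 ψ
  subsingleton_ext _ _ j _ :=
    have := projective_hom_copower h X
    Ext.subsingleton_of_projective _ _ j

theorem exact_map_of_shortExact {T : ShortComplex (ModuleCat.{u} R)} (hT : T.ShortExact) :
    Function.Exact ((extModuleFunctor R S ω 0).map T.f).hom
      ((extModuleFunctor R S ω 0).map T.g).hom := by
  have := hT.mono_f
  intro e
  constructor
  · intro he
    obtain ⟨a, rfl⟩ := (homMk S).surjective e
    rw [extModuleFunctor_map_homMk] at he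
    have ha : a ≫ T.g = 0 := (homMk S).injective (he.trans (map_zero _).symm)
    refine ⟨homMk S (hT.exact.lift a ha), ?_⟩
    rw [extModuleFunctor_map_homMk, hT.exact.lift_f]
  · rintro ⟨e, rfl⟩
    obtain ⟨a, rfl⟩ := (homMk S).surjective e
    rw [extModuleFunctor_map_homMk, extModuleFunctor_map_homMk, Category.assoc, T.zero,
      Limits.comp_zero, map_zero]

/-- If `0 → U → W → U₁ → 0` is exact with `W` a direct sum of copies of `ω`, then the conditions
on `U₁` for `k + 1` and a vanishing condition on the cokernel of
`Hom_R(ω, W) → Hom_R(ω, U₁)` imply the conditions on `U` for `k`. -/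
theorem HomApproximable.of_shortExact [Module.Finite R ω]
    (h : Function.Bijective fun s : S => Module.toModuleEnd (S := Sᵐᵒᵖ) R ω (MulOpposite.op s))
    {k : ℕ} {X : Type u} {U U₁ : ModuleCat.{u} R} {κ : U ⟶ copower R ω X}
    {p : copower R ω X ⟶ U₁} {w : κ ≫ p = 0} (hT : (ShortComplex.mk κ p w).ShortExact)
    {E : ModuleCat.{u} S} (q : (extModuleFunctor R S ω 0).obj U₁ ⟶ E)
    (hφq : Function.Exact ((extModuleFunctor R S ω 0).map p).hom q.hom)
    (hq : Function.Surjective q.hom) (hE : ExtVanishesBelow R ω (k + 1) E)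
    (hU₁ : HomApproximable R S ω (k + 1) U₁) : HomApproximable R S ω k U := by
  have hι := extModuleFunctor_zero_map_injective (ω := ω) S κ hT.injective_f
  have hιφ := exact_map_of_shortExact (S := S) (ω := ω) hT
  have hproj := projective_hom_copower h X
  have : Mono κ := hT.mono_f
  constructor
  · intro hk J hJ g hg
    -- Extend `g` along `κ` to `W`. After `Hom(ω, -)` the extension kills `Hom(ω, U)`, so it factors
    -- through `Hom(ω, U₁)`. The factor comes from some `g₁ : U₁ ⟶ J`, the extension is `p ≫ g₁`,
    -- and it therefore vanishes on `U`.
    obtain ⟨b, hb⟩ := exists_factorization_of_exact_four ((extModuleFunctor R S ω 0).map κ)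
      ((extModuleFunctor R S ω 0).map p) q hι hιφ hφq hq (hE J hJ 1 (by lia))
      ((extModuleFunctor R S ω 0).map (Injective.factorThru g κ))
      (by rw [← Functor.map_comp, Injective.comp_factorThru, hg])
    obtain ⟨g₁, rfl⟩ := hU₁.exists_map_eq (by lia) J hJ b
    rw [← Functor.map_comp] at hb
    rw [← Injective.comp_factorThru g κ, ← (map_hom_copower_bijective h X J).1 hb,
      reassoc_of% w, Limits.zero_comp]
  · intro hk J hJ ψ
    -- Extend `ψ` to `Hom(ω, W)`; there every map is induced by a morphism `W ⟶ J`, which is then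
    -- restricted to `U`.
    obtain ⟨b, rfl⟩ := exists_extension_of_exact_four ((extModuleFunctor R S ω 0).map κ)
      ((extModuleFunctor R S ω 0).map p) q hι hιφ hφq hq
      (hU₁.subsingleton_ext J hJ 0 (by lia)) (hE J hJ 2 (by lia)) ψ
    obtain ⟨g, rfl⟩ := (map_hom_copower_bijective h X J).2 b
    exact ⟨κ ≫ g, Functor.map_comp _ _ _⟩
  · intro J hJ j hj
    exact subsingleton_ext_of_exact_four ((extModuleFunctor R S ω 0).map κ)
      ((extModuleFunctor R S ω 0).map p) q hι hιφ hφq hq (j + 1)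
      (Ext.subsingleton_of_projective _ _ j)
      (hU₁.subsingleton_ext J hJ (j + 1) (by lia)) (hE J hJ (j + 3) (by lia))

/-- A morphism `p` is an epimorphism if the cokernel of `Hom_R(ω, p)` has no nonzero morphism to
any `Hom_R(ω, J)` with `J` injective. -/
theorem epi_of_extVanishesBelow {W U₁ : ModuleCat.{u} R} (p : W ⟶ U₁)
    {E : ModuleCat.{u} S} (q : (extModuleFunctor R S ω 0).obj U₁ ⟶ E)
    (hφq : Function.Exact ((extModuleFunctor R S ω 0).map p).hom q.hom)
    (hq : Function.Surjective q.hom) {k : ℕ} (hE : ExtVanishesBelow R ω (k + 1) E)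
    (hU₁ : HomApproximable R S ω (k + 1) U₁) : Epi p := by
  refine Preadditive.epi_of_cancel_zero _ fun {Z} g hg => ?_
  -- Enlarging the target to an injective module brings `g` within reach of the conditions on `U₁`
  -- and `E`.
  rw [← cancel_mono (Injective.ι Z), Limits.zero_comp]
  refine hU₁.eq_zero (by lia) _ inferInstance _ ?_
  refine eq_zero_of_comp_eq_zero_of_exact _ q hφq hq (hE _ inferInstance 0 (by lia)) _ ?_
  rw [← Functor.map_comp, reassoc_of% hg, Limits.zero_comp]
  exact (extModuleFunctor R S ω 0).map_zero _ _

/-- The level `k` varies in the induction because the step calls on level `k + 1`. Surjectivity of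
`Hom(ω, f)` is part of the conclusion because it identifies the cokernel in the next step. -/
theorem exists_approximation (hfin : HasDegreewiseFiniteResolution R (ModuleCat.of R ω))
    (h : Function.Bijective fun s : S => Module.toModuleEnd (S := Sᵐᵒᵖ) R ω (MulOpposite.op s))
    (hExt : ∀ i : ℕ, 1 ≤ i → Subsingleton (Ext (ModuleCat.of R ω) (ModuleCat.of R ω) i))
    (n : ℕ) : ∀ (k : ℕ) (M : ModuleCat.{u} R),
      (∀ i : ℕ, 1 ≤ i → i ≤ n → ExtVanishesBelow R ω (i + k) ((extModuleFunctor R S ω i).obj M)) →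
      ∃ (U : ModuleCat.{u} R) (f : U ⟶ M),
        HasCoresolutionOfLength (omegaProjective R S ω) U n ∧ HomApproximable R S ω k U ∧
        Function.Surjective ((extModuleFunctor R S ω 0).map f).hom ∧
        ∀ i : ℕ, 1 ≤ i → i ≤ n → Function.Bijective ((extModuleFunctor R S ω i).map f).hom := by
  have : Module.Finite R ω := by
    obtain ⟨P, hP⟩ := hfin
    have := hP 0
    exact Module.Finite.of_surjective (P.π.f 0).hom
      ((ModuleCat.epi_iff_surjective _).1 inferInstance)
  induction n with
  | zero =>
    intro k M _
    refine ⟨copower R ω (ModuleCat.of R ω ⟶ M), copowerDesc id,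
      hasCoresolutionOfLength_zero (omegaProjective_copower _), homApproximable_copower h _ k,
      fun e => ?_, fun i hi hi' => absurd hi (by lia)⟩
    obtain ⟨a, rfl⟩ := (homMk S).surjective e
    refine ⟨homMk S (copowerι a), ?_⟩
    rw [extModuleFunctor_map_homMk, copowerι_desc, id]
  | succ n ih =>
    intro k M hM
    let T := ShortComplex.mk (Injective.ι M) (Limits.cokernel.π (Injective.ι M)) (by simp)
    have hT : T.ShortExact := { exact := ShortComplex.exact_cokernel _ }
    have hI (i : ℕ) : Subsingleton (Ext (ModuleCat.of R ω) T.X₂ (i + 1)) :=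
      Ext.subsingleton_of_injective _ _ i
    obtain ⟨U₁, f₁, hres, hU₁, hf₁, hbij⟩ := ih (k + 1) T.X₃ fun i hi hi' => by
      obtain ⟨i, rfl⟩ := Nat.exists_eq_add_of_le' hi
      have := hM (i + 1 + 1) (by lia) (by lia)
      -- The unit lost in the Ext degree is gained in the level.
      rw [show i + 1 + 1 + k = i + 1 + (k + 1) by lia] at this
      exact this.of_iso (LinearEquiv.toModuleIso (LinearEquiv.ofBijective _
        (extConnecting_bijective hT (i + 1) (hI i) (hI (i + 1)))))
    let X := ModuleCat.of R ω ⟶ Limits.pullback f₁ T.g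
    let v : copower R ω X ⟶ Limits.pullback f₁ T.g := copowerDesc id
    let p := v ≫ Limits.pullback.fst f₁ T.g
    let c := v ≫ Limits.pullback.snd f₁ T.g
    have hpc : p ≫ f₁ = c ≫ T.g := by
      simp only [p, c, Category.assoc, Limits.pullback.condition]
    have hvι (x : X) : copowerι x ≫ v = x := copowerι_desc _ x
    -- This map exhibits `Ext¹(ω, M)` as the cokernel of `Hom(ω, p)`: a morphism `ω ⟶ U₁` dies in it
    -- exactly when its composite with `f₁` lifts to the injective module, that is, when it comes
    -- from the pullback.
    let q := (extModuleFunctor R S ω 0).map f₁ ≫ extConnecting S hT 0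
    have hq : Function.Surjective q.hom := (extConnecting_surjective hT 0 (hI 0)).comp hf₁
    have hφq : Function.Exact ((extModuleFunctor R S ω 0).map p).hom q.hom := by
      intro e
      constructor
      · intro he
        obtain ⟨a, rfl⟩ := (homMk S).surjective e
        obtain ⟨e', he'⟩ := (exact_extConnecting hT 0
          (((extModuleFunctor R S ω 0).map f₁).hom (homMk S a))).1 he
        obtain ⟨b, rfl⟩ := (homMk S).surjective e'
        rw [extModuleFunctor_map_homMk, extModuleFunctor_map_homMk] at he'
        refine ⟨homMk S (copowerι (Limits.pullback.lift a b ((homMk S).injective he').symm)), ?_⟩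
        rw [extModuleFunctor_map_homMk]
        simp only [p, reassoc_of% hvι, Limits.pullback.lift_fst]
      · rintro ⟨e, rfl⟩
        obtain ⟨a, rfl⟩ := (homMk S).surjective e
        refine (exact_extConnecting hT 0 (((extModuleFunctor R S ω 0).map f₁).hom
          (((extModuleFunctor R S ω 0).map p).hom (homMk S a)))).2 ⟨homMk S (a ≫ c), ?_⟩
        rw [extModuleFunctor_map_homMk, extModuleFunctor_map_homMk, extModuleFunctor_map_homMk,
          Category.assoc a p f₁, hpc, ← Category.assoc a c T.g]
    have hE : ExtVanishesBelow R ω (k + 1) ((extModuleFunctor R S ω (0 + 1)).obj T.X₁) := by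
      rw [add_comm]
      exact hM 1 le_rfl (by lia)
    have hp : Epi p := epi_of_extVanishesBelow p q hφq hq hE hU₁
    let T' := ShortComplex.mk (Limits.kernel.ι p) p (by simp)
    have hT' : T'.ShortExact := { exact := ShortComplex.exact_kernel p }
    have hW (i : ℕ) : Subsingleton (Ext (ModuleCat.of R ω) T'.X₂ (i + 1)) :=
      subsingleton_ext_copower hfin X i (hExt (i + 1) (by lia))
    have := hT.mono_f
    have hκc : (Limits.kernel.ι p ≫ c) ≫ T.g = 0 := by
      rw [Category.assoc, ← hpc, Limits.kernel.condition_assoc, Limits.zero_comp]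
    let f : Limits.kernel p ⟶ M := hT.exact.lift _ hκc
    have hf : f ≫ T.f = Limits.kernel.ι p ≫ c := hT.exact.lift_f _ hκc
    let F : T' ⟶ T := { τ₁ := f, τ₂ := c, τ₃ := f₁, comm₁₂ := hf, comm₂₃ := hpc.symm }
    refine ⟨Limits.kernel p, f, hres.succ hT' (omegaProjective_copower X),
      .of_shortExact h hT' q hφq hq hE hU₁, fun e => ?_, fun i hi hi' => ?_⟩
    · obtain ⟨a, rfl⟩ := (homMk S).surjective e
      -- A morphism `a : ω ⟶ M` gives the point `(0, a)` of the pullback, and the summand of `W`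
      -- that it indexes lies in the kernel of `p`.
      let x : X := Limits.pullback.lift 0 (a ≫ T.f) (by simp)
      have hx : copowerι x ≫ p = 0 := by
        simp only [p, reassoc_of% hvι, x, Limits.pullback.lift_fst]
      refine ⟨homMk S (Limits.kernel.lift p (copowerι x) hx), ?_⟩
      rw [extModuleFunctor_map_homMk]
      congr 1
      rw [← cancel_mono T.f, Category.assoc, hf, Limits.kernel.lift_ι_assoc]
      simp only [c, reassoc_of% hvι, x, Limits.pullback.lift_snd]
    · obtain ⟨i, rfl⟩ := Nat.exists_eq_add_of_le' hi
      have hnat := extConnecting_naturality (S := S) (ω := ω) hT' hT F i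
      cases i with
      | zero =>
        -- `Ext¹(ω, U)` and `Ext¹(ω, M)` are both quotients of `Hom(ω, U₁)` by the image of `Hom(ω,
        -- p)`, and naturality makes `f` compatible with the two quotient maps.
        have hδ := extConnecting_surjective (S := S) hT' 0 (hW 0)
        constructor
        · refine (injective_iff_map_eq_zero _).2 fun e he => ?_
          obtain ⟨e, rfl⟩ := hδ e
          exact (exact_extConnecting hT' 0 e).2 ((hφq e).1 ((hnat e).symm.trans he))
        · intro e
          obtain ⟨e, rfl⟩ := hq e
          exact ⟨_, hnat e⟩
      | succ i =>
        -- In the naturality square both connecting maps are bijective, so bijectivity passes from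
        -- `f₁` to `f` one degree higher.
        have hcomp := (extConnecting_bijective (S := S) (ω := ω) hT (i + 1) (hI i)
          (hI (i + 1))).comp (hbij (i + 1) (by lia) (by lia))
        refine (Function.Bijective.of_comp_iff _ (extConnecting_bijective (S := S) hT' (i + 1)
          (hW i) (hW (i + 1)))).1 ?_
        convert hcomp using 1
        exact funext hnat

end Approximation

end OmegaApprox

end

theorem theorem6p3 (R S : Type u) [Ring R] [Ring S] (ω : Type u) [AddCommGroup ω]
    [Module R ω] [Module Sᵐᵒᵖ ω] [SMulCommClass R Sᵐᵒᵖ ω] [SMulCommClass Sᵐᵒᵖ R ω]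
    (hω : OmegaApprox.IsSemidualizing R S ω) (M : ModuleCat.{u} R) (n : ℕ) (hn : 1 ≤ n)
    (hM : ∀ i : ℕ, 1 ≤ i → i ≤ n →
      (i : ℕ∞) ≤ OmegaApprox.torCograde R S ω (OmegaApprox.extModule R S ω i M)) :
    ∃ (U : ModuleCat.{u} R) (f : U ⟶ M),
      OmegaApprox.relInjectiveDimension (OmegaApprox.omegaProjective R S ω) U ≤ (n : ℕ∞) ∧
      ∀ i : ℕ, 1 ≤ i → i ≤ n →
        Function.Bijective (OmegaApprox.extModuleMap R S ω i f).hom := by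
  -- Level `0` asks nothing of the counit at `U`, and its cograde condition is exactly the
  -- hypothesis on `M`.
  obtain ⟨U, f, hU, -, -, hf⟩ := OmegaApprox.exists_approximation (S := S) hω.finite_left
    hω.homothety_right hω.ext_left n 0 M fun i hi hi' =>
      OmegaApprox.extVanishesBelow_of_le_torCograde (hM i hi hi')
  exact ⟨U, f, iInf₂_le n hU, hf⟩
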